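/- A \emph{Turing machine} $M=(Q,\Sigma,\Gamma,\delta,q_0,B,F)$ has finite sets $Q$ of states and $\Gamma$ of tape symbols, input symbols $\Sigma\subset\Gamma$, a blank $B\in\Gamma\setminus\Sigma$, a start state $q_0$, final states $F\subset Q$, and a partial transition function $\delta:Q\times\Gamma\rightharpoonup Q\times\Gamma\times\{L,R\}$. Its tape has cells $c_0,c_1,c_2,\dots$ (a leftmost cell, infinite to the right). It starts in state $q_0$ with its head on $c_0$ and the input word $w\in\Sigma^*$ written from $c_0$ on, all other cells blank. It halts if it reaches a configuration without a next move ($\delta$ is undefined, or the head would fall off the left end). A \emph{right-accelerated} Turing machine is a Turing machine that takes $1/2^n$ units of time for each step that moves the head away from cell $c_n$. On input $w$ it \emph{answers a yes/no question before time $T$} if its whole (finite or infinite) computation takes less than $T$ units of time, and it halts if the answer is yes, while if the answer is no it never halts, its head tends to infinity, and every cell is blank from some step on (a blank tape is left behind). A right-accelerated Turing machine is a \emph{hypercomputer} if there are an algorithmically undecidable yes/no-problem, a computable encoding of its instances as input words, and a finite $T$ such that the machine answers every instance before time $T$. It \emph{solves the halting problem before time $T$} if, for some computable encoding of pairs (description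 of a Turing machine $N$, input word $w$ of $N$) as input words, it answers before time $T$, for all $N$ and $w$, whether $N$ halts on $w$. A Turing machine is \emph{universal} if, for some computable encoding of such pairs as input words, it halts on the encoding of $(N,w)$ if and only if $N$ halts on $w$. \textbf{Theorem.} There exists a right-accelerated Turing machine that is a hypercomputer, and that solves the halting problem of Turing machines before time $18$. More precisely, universal Turing machines exist, and for every universal Turing machine $M_U$ with blank $B$ and tape alphabet $\Gamma$ there is a Turing machine $\overline M_U$, with tape alphabet consisting of its own blank, a delimiter $\$$, and the symbols of $\Gamma$ each in a marked and an unmarked version, such that the following holds. For an input $w$ of $M_U$ let $\$w\$$ denote $w$ enclosed by two delimiters, with its first symbol marked (if $w$ is empty, a single marked $B$ is enclosed). \begin{enumerate} \item On $\$w\$$, $\overline M_U$ simulates $M_U$ on $w$ in cycles, each of which performs one step of $M_U$ and shifts the whole tape content one cell to the right. That is, whenever $M_U$ on $w$ reaches a configuration after $k$ steps, $\overline M_U$ starts its cycle number $k$ (cycle $0$ at its initial configuration, later cycles strictly later) with its head on a delimiter in $c_k$, followed by a finite initial segment of the tape of $M_U$ that contains all its non-blank cells and the head position of $M_U$, which is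 the only marked cell, followed by a delimiter; all other cells are blank, and the state of $M_U$ is determined by the state of $\overline M_U$, through an injective map from the states of $M_U$ to those of $\overline M_U$ that does not depend on $w$ or $k$. If $M_U$ halts in that configuration, then $\overline M_U$ halts, at the start of that cycle or later, and its last state is final if and only if that of $M_U$ is. \item As a right-accelerated machine, $\overline M_U$ on input $\$w\$$ answers before time $18$ whether $M_U$ halts on $w$. \item As a right-accelerated machine, $\overline M_U$ solves the halting problem of Turing machines before time $18$, and is a hypercomputer. \end{enumerate} -/

import Mathlib

open scoped ENNReal

/-- A deterministic one-tape Turing machine `(Q, Σ, Γ, δ, q₀, B, F)`, whose tape has a leftmost cell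
and is infinite to the right. The partial transition function returns `none` where it is undefined.
Finiteness of `Q` and `Γ` is always stated separately, by `[Finite Q] [Finite Γ]`. -/
structure TM (Q Γ : Type) where
  inputSymbols : Finset Γ
  blank : Γ
  blank_notMem : blank ∉ inputSymbols
  start : Q
  final : Finset Q
  δ : Q → Γ → Option (Q × Γ × Turing.Dir)

/-- A configuration: the state, the contents of the cells `c_0, c_1, …`, and the index of the cell
under the head. -/
structure TMCfg (Q Γ : Type) where
  state : Q
  tape : ℕ → Γ
  head : ℕ

namespace TM

variable {Q Γ : Type} (M : TM Q Γ)

/-- `w ∈ Σ*`. -/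
def IsInput (w : List Γ) : Prop := ∀ a ∈ w, a ∈ M.inputSymbols

/-- One move. There is no move if `δ` is undefined or if the head would fall off the left end. -/
def step (c : TMCfg Q Γ) : Option (TMCfg Q Γ) :=
  match M.δ c.state (c.tape c.head) with
  | none => none
  | some (p, b, Turing.Dir.right) => some ⟨p, Function.update c.tape c.head b, c.head + 1⟩
  | some (p, b, Turing.Dir.left) =>
      if c.head = 0 then none else some ⟨p, Function.update c.tape c.head b, c.head - 1⟩

/-- The input word stands at the left end of the tape, all other cells are blank, and the head
stands on `c_0`. -/
def init (w : List Γ) : TMCfg Q Γ := ⟨M.start, fun i => w.getD i M.blank, 0⟩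

/-- The configuration after `n` moves on input `w`; `none` if fewer than `n` moves are possible. -/
def run (w : List Γ) : ℕ → Option (TMCfg Q Γ)
  | 0 => some (M.init w)
  | n + 1 => (run w n).bind M.step

/-- On input `w` the machine reaches, after finitely many moves, a configuration without a next
move. -/
def HaltsOn (w : List Γ) : Prop := ∃ n c, M.run w n = some c ∧ M.step c = none

/-- The right-accelerated time schedule: the duration of move number `n` (counted from `0`) on
input `w` is `1 / 2 ^ i` if that move leaves the cell `c_i`; it is `0` if there is no such move. -/
noncomputable def stepTime (w : List Γ) (n : ℕ) : ℝ≥0∞ :=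
  match M.run w n with
  | none => 0
  | some c =>
    match M.step c with
    | none => 0
    | some _ => 1 / 2 ^ c.head

/-- The duration of the whole, finite or infinite, computation on input `w` of `M` as a
right-accelerated Turing machine. -/
noncomputable def totalTime (w : List Γ) : ℝ≥0∞ := ∑' n, M.stepTime w n

/-- On input `w` the machine runs through infinitely many moves, its head tends to infinity, and
every cell is blank from some move on. -/
def VanishesOn (w : List Γ) : Prop :=
  (∀ n, M.run w n ≠ none) ∧
    ∀ i, ∃ N, ∀ n, N ≤ n → ∀ c, M.run w n = some c → i < c.head ∧ c.tape i = M.blank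

/-- On the input word `w` the right-accelerated machine answers the question `p` before time `T`:
all its activity takes less than `T` units of time; if `p` holds it halts, and if
`p` does not hold its head vanishes to infinity and leaves a blank tape behind. -/
def AnswersBefore (T : ℝ≥0∞) (w : List Γ) (p : Prop) : Prop :=
  M.IsInput w ∧ M.totalTime w < T ∧ (p → M.HaltsOn w) ∧ (¬ p → M.VanishesOn w)

end TM

/-- Computability of an encoding of objects as words over a finite alphabet. -/
def ComputableEncoding {α Γ : Type} [Primcodable α] (enc : α → List Γ) : Prop :=
  ∃ (g : ℕ) (e : Γ ≃ Fin g), Computable fun x => (enc x).map e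

/-- Finite descriptions of Turing machines: the numbers of states and of symbols, the start state
and the blank, the lists of input symbols and of final states, and the list of the quintuples
`((q, a), (p, b, D))` with `δ (q, a) = (p, b, D)`, where `true` stands for the direction right. -/
abbrev TMDescription : Type :=
  (ℕ × ℕ) × (ℕ × ℕ) × (List ℕ × List ℕ) × List ((ℕ × ℕ) × (ℕ × ℕ × Bool))

namespace TM

/-- The description of a Turing machine with states `0, …, s - 1` and tape symbols
`0, …, g - 1`. -/
def description {s g : ℕ} (M : TM (Fin s) (Fin g)) : TMDescription :=
  ((s, g), (M.start.val, M.blank.val),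
    (((List.finRange g).filter (· ∈ M.inputSymbols)).map Fin.val,
      ((List.finRange s).filter (· ∈ M.final)).map Fin.val),
    (List.finRange s ×ˢ List.finRange g).filterMap fun qa =>
      (M.δ qa.1 qa.2).map fun r =>
        ((qa.1.val, qa.2.val), (r.1.val, r.2.1.val, decide (r.2.2 = Turing.Dir.right))))

variable {Q Γ : Type} (M : TM Q Γ)

/-- `M` is a universal machine: given a computable encoding of a pair of a Turing machine `N` and
an input word `w` of `N`, it halts if and only if `N` halts on `w`. -/
def IsUniversal : Prop :=
  ∃ code : TMDescription × List ℕ → List Γ, ComputableEncoding code ∧ (∀ x, M.IsInput (code x)) ∧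
    ∀ (s g : ℕ) (N : TM (Fin s) (Fin g)) (w : List (Fin g)), N.IsInput w →
      (M.HaltsOn (code (N.description, w.map Fin.val)) ↔ N.HaltsOn w)

/-- As a right-accelerated machine, and with a computable encoding of the instances, `M` answers
before time `T` for each Turing machine `N` and each input word `w` of `N` whether `N` halts
on `w`. -/
def SolvesHaltingProblemBefore (T : ℝ≥0∞) : Prop :=
  ∃ code : TMDescription × List ℕ → List Γ, ComputableEncoding code ∧
    ∀ (s g : ℕ) (N : TM (Fin s) (Fin g)) (w : List (Fin g)), N.IsInput w →
      M.AnswersBefore T (code (N.description, w.map Fin.val)) (N.HaltsOn w)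

/-- As a right-accelerated machine, `M` is a hypercomputer: with a computable encoding of the
instances, it decides within a finite time a yes/no-problem that is algorithmically undecidable. -/
def IsHypercomputer : Prop :=
  ∃ (α : Type) (_ : Primcodable α) (P : α → Prop) (code : α → List Γ) (T : ℝ≥0∞),
    ¬ ComputablePred P ∧ ComputableEncoding code ∧ T < ⊤ ∧ ∀ x, M.AnswersBefore T (code x) (P x)

end TM

/-- The tape symbols of a simulating machine: its blank, the delimiter `$`, and the symbols of the
simulated machine together with an additional track that marks a cell or does not. -/
inductive TrackSymbol (Γ : Type) where
  | blank : TrackSymbol Γ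
  | delim : TrackSymbol Γ
  | cell : Γ → Bool → TrackSymbol Γ

namespace TM

variable {Q Γ Q' : Type}

/-- The input word `w` of `U` surrounded by delimiters, with its first cell marked; if `w` is
empty, a single marked blank of `U` stands between the delimiters. -/
def frame (U : TM Q Γ) (w : List Γ) : List (TrackSymbol Γ) :=
  [TrackSymbol.delim] ++
    (match w with
      | [] => [TrackSymbol.cell U.blank true]
      | a :: l => TrackSymbol.cell a true :: l.map fun b => TrackSymbol.cell b false) ++
    [TrackSymbol.delim]

/-- The tape that carries, shifted by `k` cells, a left delimiter, the first `m` cells of the tape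
of `c` with the cell under the head of `c` marked, and a right delimiter; it is blank elsewhere. -/
def shiftedTape (k m : ℕ) (c : TMCfg Q Γ) (j : ℕ) : TrackSymbol Γ :=
  if j < k then TrackSymbol.blank
  else if j = k then TrackSymbol.delim
  else if j < k + 1 + m then
    TrackSymbol.cell (c.tape (j - (k + 1))) (decide (j - (k + 1) = c.head))
  else if j = k + 1 + m then TrackSymbol.delim
  else TrackSymbol.blank

/-- `d` represents the configuration `c` of `U`, shifted by `k` cells to the right: the head of `d`
is on the left delimiter in `c_k`, the state of `U` is stored in the finite control, and the head
and all non-blank symbols of `c` lie between the delimiters. -/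
def Represents (U : TM Q Γ) (σ : Q → Q') (k : ℕ) (c : TMCfg Q Γ)
    (d : TMCfg Q' (TrackSymbol Γ)) : Prop :=
  d.state = σ c.state ∧ d.head = k ∧
    ∃ m, c.head < m ∧ (∀ i, m ≤ i → c.tape i = U.blank) ∧ d.tape = shiftedTape k m c

/-- On framed inputs `V` simulates `U` in cycles, each of which performs one move of `U` and shifts
the tape content one cell to the right: at the start of cycle `k` (after `t k` moves of `V`) it
represents the configuration of `U` after `k` moves, shifted by `k` cells. When `U`
halts, so does `V`, and its last state is final if and only if that of `U` is. -/
def ShiftSimulates (V : TM Q' (TrackSymbol Γ)) (U : TM Q Γ) : Prop :=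
  ∃ σ : Q → Q', Function.Injective σ ∧ ∀ w, U.IsInput w →
    ∃ t : ℕ → ℕ, t 0 = 0 ∧ StrictMono t ∧ ∀ k c, U.run w k = some c →
      (∃ d, V.run (U.frame w) (t k) = some d ∧ U.Represents σ k c d) ∧
      (U.step c = none → ∃ n e, t k ≤ n ∧ V.run (U.frame w) n = some e ∧ V.step e = none ∧
        (e.state ∈ V.final ↔ c.state ∈ U.final))

end TM

/-!
The simulating machine `TM.shiftMachine U` performs one move of `U` in each cycle. A cycle starts on
the left delimiter, in `c_k`, and consists of a sweep to the right, which moves every symbol one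
cell to the right, and a sweep back. During the sweep to the right the symbol read last is kept in the
finite control, so when the marked cell is met its left neighbour has not been written yet, and
either neighbour can receive the mark; thus one sweep suffices for a move of `U`
(`TM.path_cycle`, `TM.path_halt`). In cycle `k` each cell `c_j` with `j ≥ k` is left at most twice,
so cycle `k` takes less than `3 / 2 ^ k` units of time. The bookkeeping is done with a potential
(`TM.Path`): at the start of cycle `k`, at most `5 / 2 ^ k` units are still needed. Hence every
computation takes at most `5` units (`TM.shiftMachine_totalTime_le`). If `U` does not halt, the head
stays at or to the right of `c_k` from cycle `k` on and leaves only blanks behind, so it vanishes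
(`TM.shiftMachine_vanishesOn`).

For the existence of universal machines and for undecidability, every recursively enumerable
problem is shown to be the halting problem of a fixed Turing machine under a computable encoding
(`REPred.exists_TM`). Mathlib compiles partial recursive functions to machines with a two-way
infinite tape; such a tape is folded at its origin to obtain a tape with a leftmost cell
(`FoldedTape.haltsOn_encode`). Applied to the halting problem of described machines, which is
recursively enumerable by a primitive recursive step function
(`TMDescription.rePred_run_eq_none`), this gives a universal machine. Applied to the halting problem
of partial recursive functions, it gives one machine whose halting is undecidable, and a universal
machine can be asked about that machine (`TM.not_computablePred_of_universal`).
-/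

/-! ### Runs, halting, and renaming of states and symbols -/

namespace TM

variable {Q Γ : Type} (M : TM Q Γ)

theorem haltsOn_iff_eval_dom (w : List Γ) :
    M.HaltsOn w ↔ (StateTransition.eval M.step (M.init w)).Dom := by
  have reach : ∀ c, StateTransition.Reaches M.step (M.init w) c ↔ ∃ n, M.run w n = some c := by
    refine fun c => ⟨fun h => ?_, ?_⟩
    · induction h with
      | refl => exact ⟨0, rfl⟩
      | tail _ hbc ih =>
        obtain ⟨n, hn⟩ := ih
        exact ⟨n + 1, by simpa [run, hn] using hbc⟩
    · rintro ⟨n, hn⟩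
      induction n generalizing c with
      | zero => cases hn; exact .refl
      | succ n ih =>
        obtain ⟨b, hb, hbc⟩ := Option.bind_eq_some_iff.1 hn
        exact .tail (ih b hb) hbc
  simp only [HaltsOn, Part.dom_iff_mem, StateTransition.mem_eval, reach]
  exact ⟨fun ⟨n, c, h, h'⟩ => ⟨c, ⟨n, h⟩, h'⟩, fun ⟨c, ⟨n, h⟩, h'⟩ => ⟨n, c, h, h'⟩⟩

/-- The machine obtained by renaming the states and the tape symbols. -/
def relabel {Q' Γ' : Type} (f : Q ≃ Q') (e : Γ ≃ Γ') : TM Q' Γ' where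
  inputSymbols := M.inputSymbols.map e.toEmbedding
  blank := e M.blank
  blank_notMem := by simpa using M.blank_notMem
  start := f M.start
  final := M.final.map f.toEmbedding
  δ q a := (M.δ (f.symm q) (e.symm a)).map fun r => (f r.1, e r.2.1, r.2.2)

theorem relabel_haltsOn {Q' Γ' : Type} (f : Q ≃ Q') (e : Γ ≃ Γ') (w : List Γ) :
    (M.relabel f e).HaltsOn (w.map e) ↔ M.HaltsOn w := by
  rw [haltsOn_iff_eval_dom, haltsOn_iff_eval_dom]
  refine StateTransition.tr_eval_dom (f₁ := M.step) (f₂ := (M.relabel f e).step)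
    (tr := fun c d => (⟨f c.state, e ∘ c.tape, c.head⟩ : TMCfg Q' Γ') = d)
    (StateTransition.fun_respects.2 ?_) ?_
  · rintro ⟨q, T, h⟩
    have hup : ∀ b, e ∘ Function.update T h b = Function.update (e ∘ T) h (e b) := fun b =>
      Function.comp_update _ _ _ _
    rcases hδ : M.δ q (T h) with - | ⟨p, b, - | -⟩
    · simp [step, relabel, hδ, StateTransition.FRespects]
    · by_cases h0 : h = 0
      · simp [step, relabel, h0, StateTransition.FRespects]
        simp [← h0, hδ]
      · simp only [step, hδ, h0, if_false, StateTransition.FRespects]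
        exact .single (by simp [step, relabel, hδ, h0, hup])
    · simp only [step, hδ, StateTransition.FRespects]
      exact .single (by simp [step, relabel, hδ, hup])
  · simp only [init, relabel, TMCfg.mk.injEq, true_and, and_true, funext_iff, Function.comp_apply]
    intro i
    simp only [List.getD_eq_getElem?_getD, List.getElem?_map]
    cases w[i]? <;> rfl

end TM

/-! ### Folding a two-way infinite tape -/

namespace FoldedTape

open Turing

variable {Γ Λ : Type} [Inhabited Γ] [Inhabited Λ]

/-- A cell of the folded tape. Cell `n` holds the symbols of the cells `n` and `-1 - n` of the
two-way infinite tape and a flag for `n = 0`; the blank `none` stands for two default symbols. -/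
abbrev Cell (Γ : Type) := Option (Γ × Γ × Bool)

/-- The two symbols and the flag in a cell of the folded tape. -/
def Cell.content (a : Cell Γ) : Γ × Γ × Bool := a.getD (default, default, false)

/-- The one-way machine for a machine `M` with a two-way infinite tape, supported by the finite set
`S` of states. A state `(q, up, back)` consists of the state `q` of `M`, the half of the tape its
head is on, and a flag for a move to the right that is to be undone. -/
noncomputable def machine [Finite Γ] (M : Λ → Γ → Option (Λ × TM0.Stmt Γ)) (S : Set Λ)
    (hS : default ∈ S) : TM (S × Bool × Bool) (Cell Γ) where
  inputSymbols := (Set.toFinite {none}ᶜ).toFinset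
  blank := none
  blank_notMem := by simp
  start := (⟨default, hS⟩, true, false)
  final := ∅
  δ s a :=
    open Classical in
    let x := Cell.content a
    match s with
    | (q, up, true) => some ((q, up, false), a, Dir.left)
    | (q, up, false) =>
      match M q (if up then x.1 else x.2.1) with
      | none => none
      | some (q', t) =>
        if h : q' ∈ S then
          match t with
          | .write b =>
            some ((⟨q', h⟩, up, true), if up then (b, x.2.1, x.2.2) else (x.1, b, x.2.2), Dir.right)
          | .move d =>
            if up = decide (d = Dir.right) then some ((⟨q', h⟩, up, false), a, Dir.right)
            else if x.2.2 then some ((⟨q', h⟩, !up, true), a, Dir.right)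
            else some ((⟨q', h⟩, up, false), a, Dir.left)
        else none

/-- The position, on the two-way infinite tape, of the given half of cell `n`. -/
def position (up : Bool) (n : ℕ) : ℤ := if up then n else -1 - n

/-- The configuration of the folded machine represents that of the two-way machine. As the cells of
a `Tape` are numbered relative to its head, cell `i` of the two-way tape is `i - position up n` there
if the head is on the given half of cell `n`. -/
def Folds {S : Set Λ} (c : TM0.Cfg Γ Λ) (d : TMCfg (S × Bool × Bool) (Cell Γ)) : Prop :=
  d.state.1 = c.q ∧ d.state.2.2 = false ∧ ∀ n, (d.tape n).content =
    (c.Tape.nth (n - position d.state.2.1 d.head),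
      c.Tape.nth (-1 - n - position d.state.2.1 d.head), decide (n = 0))

variable [Finite Γ] {M : Λ → Γ → Option (Λ × TM0.Stmt Γ)} {S : Set Λ} (hS : TM0.Supports M S)

theorem step_back (q : S) (up : Bool) (tape : ℕ → Cell Γ) (h : ℕ) :
    (machine M S hS.1).step ⟨(q, up, true), tape, h + 1⟩ = some ⟨(q, up, false), tape, h⟩ := by
  simp [TM.step, machine]

/-- The transition of the folded machine that belongs to a transition of the two-way machine. -/
theorem machine_δ {q p : Λ} (hq : q ∈ S) (hp : p ∈ S) {up : Bool} {a : Cell Γ} {t : TM0.Stmt Γ}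
    (hM : M q (if up then a.content.1 else a.content.2.1) = some (p, t)) :
    (machine M S hS.1).δ (⟨q, hq⟩, up, false) a =
      match t with
      | .write b => some ((⟨p, hp⟩, up, true), some (if up then (b, a.content.2)
          else (a.content.1, b, a.content.2.2)), Dir.right)
      | .move d =>
        if up = decide (d = Dir.right) then some ((⟨p, hp⟩, up, false), a, Dir.right)
        else if a.content.2.2 then some ((⟨p, hp⟩, !up, true), a, Dir.right)
        else some ((⟨p, hp⟩, up, false), a, Dir.left) := by
  simp only [machine, hM, hp, dif_pos]
  cases t <;> cases up <;> rfl

/-- At most two moves of the folded machine correspond to each move of the two-way machine. -/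
theorem respects : StateTransition.Respects (TM0.step M) (machine M S hS.1).step Folds := by
  rintro ⟨q, T⟩ ⟨⟨⟨q', hq⟩, up, back⟩, tape, h⟩ ⟨h1, h2, h3⟩
  obtain rfl : q' = q := h1
  obtain rfl : back = false := h2
  dsimp only at h3
  have hread : T.head = if up then (Cell.content (tape h)).1 else (Cell.content (tape h)).2.1 := by
    rw [h3 h]; cases up <;> simp [position]
  have hflag : (Cell.content (tape h)).2.2 = decide (h = 0) := by rw [h3 h]
  rcases hM : M q' T.head with - | ⟨p, t⟩
  · simp [TM0.step, hM, TM.step, machine, ← hread]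
  have hp : p ∈ S := hS.2 hM hq
  simp only [TM0.step, hM, Option.map_some]
  cases t with
  | write b =>
    let new : Γ × Γ × Bool := if up then (b, (Cell.content (tape h)).2) else
      ((Cell.content (tape h)).1, b, (Cell.content (tape h)).2.2)
    refine ⟨⟨(⟨p, hp⟩, up, false), Function.update tape h (some new), h⟩, ⟨rfl, rfl, fun n => ?_⟩,
      .tail (.single (b := ⟨(⟨p, hp⟩, up, true), Function.update tape h (some new), h + 1⟩) ?_)
        (step_back hS _ _ _ _)⟩
    · have h3' := h3 n
      simp only [Tape.write_nth]
      rcases eq_or_ne n h with rfl | hn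
      · have hne : (n : ℤ) - (-1 - n) ≠ 0 := by omega
        have hne' : -1 - (n : ℤ) - n ≠ 0 := by omega
        cases up <;> simp [Cell.content, new, position, hne, hne'] <;>
          simp [Cell.content, position] at h3' <;> simp [h3']
      · rw [Function.update_of_ne hn, h3']
        cases up
        · have a1 : (n : ℤ) - (-1 - h) ≠ 0 := by omega
          have a2 : -1 - (n : ℤ) - (-1 - h) ≠ 0 := by omega
          simp only [position, Bool.false_eq_true, if_false, a1, a2]
        · have a1 : (n : ℤ) - h ≠ 0 := by omega
          have a2 : -1 - (n : ℤ) - h ≠ 0 := by omega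
          simp only [position, if_true, a1, a2, if_false]
    · simp [TM.step, machine_δ hS hq hp (hread ▸ hM), new]
  | move d =>
    have key : ∀ up' h', position up' h' = position up h + (if d = Dir.right then 1 else -1) →
        Folds (S := S) ⟨p, T.move d⟩ ⟨(⟨p, hp⟩, up', false), tape, h'⟩ := by
      refine fun up' h' hpos => ⟨rfl, rfl, fun n => ?_⟩
      dsimp only
      rw [h3 n, hpos]
      cases d
      · simp only [Tape.move_left_nth, reduceCtorEq, if_false]
        ring_nf
      · simp only [Tape.move_right_nth, if_true]
        ring_nf
    have hδ := machine_δ hS hq hp (hread ▸ hM)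
    by_cases hout : up = decide (d = Dir.right)
    · refine ⟨⟨(⟨p, hp⟩, up, false), tape, h + 1⟩, key _ _ ?_, .single ?_⟩
      · subst hout
        cases d <;> (simp [position]; try ring)
      · simp only [TM.step, hδ]
        simp [← hout]
    · by_cases h0 : h = 0
      · refine ⟨⟨(⟨p, hp⟩, !up, false), tape, h⟩, key _ _ ?_,
          .tail (.single (b := ⟨(⟨p, hp⟩, !up, true), tape, h + 1⟩) ?_) (step_back hS _ _ _ _)⟩
        · subst h0
          clear hδ key h3 hread hflag hM
          cases up <;> cases d <;> simp_all [position]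
        · subst h0
          simp only [TM.step, hδ]
          simp [hout, hflag]
      · obtain ⟨k, rfl⟩ := Nat.exists_eq_succ_of_ne_zero h0
        refine ⟨⟨(⟨p, hp⟩, up, false), tape, k⟩, key _ _ ?_, .single ?_⟩
        · clear hδ key h3 hread hflag hM
          cases up <;> cases d <;> (simp_all [position]; try ring)
        · simp only [TM.step, hδ]
          simp [hout, hflag]

/-- The input word of the folded machine for the input word `l` of the two-way machine. -/
def encode (l : List Γ) : List (Cell Γ) :=
  some (l.headI, default, true) :: l.tail.map fun a => some (a, default, false)

theorem isInput_encode (l : List Γ) : (machine M S hS.1).IsInput (encode l) := by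
  intro a ha
  have : a ≠ none := by
    rintro rfl
    cases l <;> simp [encode] at ha
  simpa [machine] using this

theorem folds_init (l : List Γ) : Folds (TM0.init l) ((machine M S hS.1).init (encode l)) := by
  refine ⟨rfl, rfl, fun n => ?_⟩
  have hneg : (Tape.mk₁ l).nth (-1 - n) = default := by
    have : (-1 - n : ℤ) = -((n + 1 : ℕ) : ℤ) := by push_cast; ring
    rw [this]
    change ListBlank.nth (ListBlank.mk []) n = default
    simp [ListBlank.nth_mk, List.getI]
  have hpos : (Tape.mk₁ l).nth n = l.getI n := by
    change (Tape.mk' (ListBlank.mk []) (ListBlank.mk l)).nth n = _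
    rw [Tape.mk'_nth_nat, ListBlank.nth_mk]
  simp only [TM.init, machine, position, if_true, Nat.cast_zero, sub_zero, TM0.init, hneg, hpos]
  cases n with
  | zero => cases l <;> simp [encode, Cell.content]
  | succ n =>
    rcases l with - | ⟨a, l⟩
    · simp [encode, Cell.content]
    · have h1 : (a :: l).getI (n + 1) = l[n]?.getD default := by
        rw [List.getI_cons_succ, List.getI_eq_getElem?_getD]
      have h2 : (encode (a :: l)).getD (n + 1) none =
          (l[n]?.map fun a => some (a, default, false)).getD none := by
        simp [encode]
      rw [h1, h2]
      cases l[n]? <;> simp [Cell.content]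

theorem haltsOn_encode (l : List Γ) :
    (machine M S hS.1).HaltsOn (encode l) ↔ (TM0.eval M l).Dom := by
  rw [TM.haltsOn_iff_eval_dom]
  exact StateTransition.tr_eval_dom (respects hS) (folds_init hS l)

end FoldedTape

/-! ### A Turing machine for every recursively enumerable problem -/

namespace Turing

/-- A finitely supported multi-stack machine is simulated by a one-tape machine with a one-way
infinite tape. -/
theorem TM2.exists_TM {K : Type} [DecidableEq K] [Fintype K] {Γ : K → Type} [∀ k, Fintype (Γ k)]
    {Λ σ : Type} [Inhabited Λ] [Inhabited σ] [Fintype σ] (M : Λ → TM2.Stmt Γ Λ σ) (S : Finset Λ)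
    (hS : TM2.Supports M S) (k : K) :
    ∃ (Q : Type) (_ : Finite Q) (V : TM Q (FoldedTape.Cell (TM2to1.Γ' K Γ))), ∀ L,
      V.IsInput (FoldedTape.encode (TM2to1.trInit k L)) ∧
        (V.HaltsOn (FoldedTape.encode (TM2to1.trInit k L)) ↔ (TM2.eval M k L).Dom) := by
  have hS₁ := TM2to1.tr_supports M hS
  have hS₀ := TM1to0.tr_supports (TM2to1.tr M) hS₁
  refine ⟨_, inferInstance, FoldedTape.machine (TM1to0.tr (TM2to1.tr M)) _ hS₀.1, fun L =>
    ⟨FoldedTape.isInput_encode hS₀ _, ?_⟩⟩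
  rw [← TM2to1.tr_eval_dom, ← TM1to0.tr_eval]
  exact FoldedTape.haltsOn_encode hS₀ _

namespace PartrecToTM2

/-- The binary digits of `n`, least significant first, are its input for the stack machine. -/
theorem trNat_eq_map_bits (n : ℕ) :
    trNat n = n.bits.map fun b => cond b Γ'.bit1 Γ'.bit0 := by
  have h : ∀ p : PosNum, trPosNum p = (p : ℕ).bits.map fun b => cond b Γ'.bit1 Γ'.bit0 := by
    intro p
    induction p with
    | one => simp [trPosNum]
    | bit0 p ih =>
      rw [trPosNum, ih, PosNum.cast_bit0, ← two_mul, Nat.bit0_bits _ (PosNum.cast_pos p).ne']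
      rfl
    | bit1 p ih =>
      rw [trPosNum, ih, PosNum.cast_bit1, ← two_mul, Nat.bit1_bits]
      rfl
  rw [trNat]
  conv_rhs => rw [← Num.to_of_nat n]
  cases (n : Num) with
  | zero => simp [trNum]
  | pos p => exact h p

end PartrecToTM2

end Turing

theorem Primrec.nat_bits : Primrec Nat.bits := by
  have h : Primrec₂ fun (_ : Unit) (l : List (List Bool)) =>
      some (if l.length = 0 then ([] : List Bool)
        else l.length.bodd :: l.getD l.length.div2 []) := by
    have hlen : Primrec fun p : Unit × List (List Bool) => p.2.length :=
      Primrec.list_length.comp Primrec.snd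
    refine Primrec.option_some.comp (Primrec.ite (Primrec.eq.comp hlen (Primrec.const 0))
      (Primrec.const []) (Primrec.list_cons.comp (Primrec.nat_bodd.comp hlen)
        ((Primrec.list_getD []).comp Primrec.snd (Primrec.nat_div2.comp hlen))))
  refine (Primrec.nat_strong_rec (fun _ : Unit => Nat.bits) h fun _ n => ?_).comp
    (Primrec.const ()) Primrec.id
  rcases eq_or_ne n 0 with rfl | hn
  · simp
  · have hlt : n.div2 < n := by rw [Nat.div2_val]; omega
    simp [hn, hlt]
    conv_rhs => rw [← Nat.bit_bodd_div2 n]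
    rw [Nat.bits_append_bit]
    intro h0
    rw [Nat.div2_val] at h0
    have : n = 1 := by omega
    subst this; rfl

namespace Turing.PartrecToTM2

instance : Fintype K' :=
  ⟨{K'.main, K'.rev, K'.aux, K'.stack}, fun k => by cases k <;> simp⟩

/-- A partial recursive function is evaluated by a one-tape machine that halts exactly on the
arguments in its domain. -/
theorem exists_TM (c : ToPartrec.Code) :
    ∃ (Q : Type) (_ : Finite Q) (V : TM Q (FoldedTape.Cell (TM2to1.Γ' K' fun _ => Γ'))), ∀ v,
      V.IsInput (FoldedTape.encode (TM2to1.trInit K'.main (trList v))) ∧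
        (V.HaltsOn (FoldedTape.encode (TM2to1.trInit K'.main (trList v))) ↔ (c.eval v).Dom) := by
  let : Inhabited Λ' := ⟨trNormal c Cont'.halt⟩
  obtain ⟨Q, hQ, V, hV⟩ := TM2.exists_TM tr (codeSupp c Cont'.halt) (tr_supports c _) K'.main
  refine ⟨Q, hQ, V, fun v => ⟨(hV _).1, (hV _).2.trans ?_⟩⟩
  have hinit : (TM2.init K'.main (trList v) : TM2.Cfg (fun _ : K' => Γ') Λ' (Option Γ')) =
      init c v := by
    simp only [TM2.init, init]
    congr 1
    funext k
    cases k <;> rfl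
  change (StateTransition.eval (TM2.step tr) (TM2.init K'.main (trList v))).Dom ↔ _
  rw [hinit, tr_eval]
  rfl

/-- The input words for single numbers form a computable encoding. -/
theorem primrec_input {g : ℕ} (e : FoldedTape.Cell (TM2to1.Γ' K' fun _ => Γ') → Fin g) :
    Primrec fun n => (FoldedTape.encode (TM2to1.trInit K'.main (trList [n]))).map e := by
  let φ : Γ' → TM2to1.Γ' K' fun _ => Γ' := fun a =>
    (false, Function.update (fun _ => none) K'.main (some a))
  let ψ : Bool → Fin g := fun b => e (some (φ (cond b Γ'.bit1 Γ'.bit0), default, false))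
  refine (Primrec.list_cons.comp (Primrec.const (e (some ((true, (φ Γ'.cons).2), default, true))))
    (Primrec.list_map (Primrec.list_reverse.comp Primrec.nat_bits)
      ((Primrec.dom_finite ψ).comp₂ Primrec₂.right))).of_eq fun n => ?_
  have hlist : trList [n] = (n.bits.map fun b => cond b Γ'.bit1 Γ'.bit0) ++ [Γ'.cons] := by
    rw [← trNat_eq_map_bits]
    rfl
  have hinit : ∀ (L : List Γ') a,
      FoldedTape.encode (TM2to1.trInit (Γ := fun _ => Γ') K'.main (L ++ [a])) =
      some ((true, (φ a).2), default, true) ::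
        (L.reverse.map φ).map fun x => some (x, default, false) := fun L a => by
    rw [TM2to1.trInit, List.reverse_append]
    rfl
  rw [hlist, hinit]
  refine congrArg (_ :: ·) ?_
  rw [← List.map_reverse]
  induction n.bits.reverse with
  | nil => rfl
  | cons b l ih => exact congrArg (_ :: ·) ih

end Turing.PartrecToTM2

/-- For every recursively enumerable problem there is a Turing machine that halts exactly on the
encodings of the instances with a positive answer. -/
theorem REPred.exists_TM {α : Type} [Primcodable α] {p : α → Prop} (hp : REPred p) :
    ∃ (s g : ℕ) (M : TM (Fin s) (Fin g)) (enc : α → List (Fin g)), Computable enc ∧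
      ∀ x, M.IsInput (enc x) ∧ (M.HaltsOn (enc x) ↔ p x) := by
  let f : List.Vector ℕ 1 →. ℕ := fun v => (Part.ofOption (Encodable.decode (α := α) v.head)).bind
    fun a => (Part.assert (p a) fun _ => Part.some ()).map fun _ => 0
  have hf : Partrec f := Partrec.bind
    (Computable.ofOption (Computable.decode.comp Primrec.vector_head.to_comp))
    (Partrec.map (hp.comp Computable.snd) (Computable.const 0).to₂)
  obtain ⟨c, hc⟩ := Turing.ToPartrec.Code.exists_code (Nat.Partrec'.of_part hf)
  obtain ⟨Q, hQ, V, hV⟩ := Turing.PartrecToTM2.exists_TM c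
  obtain ⟨s, ⟨es⟩⟩ := Finite.exists_equiv_fin Q
  obtain ⟨g, ⟨eg⟩⟩ := Finite.exists_equiv_fin
    (FoldedTape.Cell (Turing.TM2to1.Γ' Turing.PartrecToTM2.K' fun _ => Turing.PartrecToTM2.Γ'))
  refine ⟨s, g, V.relabel es eg, _,
    ((Turing.PartrecToTM2.primrec_input eg).comp Primrec.encode).to_comp, fun x => ⟨?_, ?_⟩⟩
  · intro a ha
    obtain ⟨b, hb, rfl⟩ := List.mem_map.1 ha
    exact Finset.mem_map_of_mem _ ((hV [Encodable.encode x]).1 b hb)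
  · rw [TM.relabel_haltsOn, (hV _).2]
    have := congrArg Part.Dom (hc ⟨[Encodable.encode x], rfl⟩)
    change (c.eval [Encodable.encode x]).Dom = (f _).Dom at this
    rw [this]
    simp [f, List.Vector.head, Part.assert]

/-! ### The halting problem of described machines is recursively enumerable -/

namespace TMDescription

/-- A configuration of a described machine: the state, an initial segment of the tape that is
continued by blanks, and the position of the head. -/
abbrev Cfg : Type := ℕ × List ℕ × ℕ

/-- The symbol in cell `i` of the tape with initial segment `l` and the given blank. -/
def read (blank : ℕ) (l : List ℕ) (i : ℕ) : ℕ := l[i]?.getD blank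

/-- The initial segment `l`, extended if necessary, with `b` written into cell `h`. -/
def write (blank : ℕ) (l : List ℕ) (h b : ℕ) : List ℕ :=
  (List.range (l.length + h + 1)).map fun i => if i = h then b else read blank l i

theorem read_write (blank : ℕ) (l : List ℕ) (h b i : ℕ) :
    read blank (write blank l h b) i = if i = h then b else read blank l i := by
  by_cases hi : i < l.length + h + 1
  · simp [read, write, hi]
  · have h1 : i ≠ h := by omega
    have h2 : l.length ≤ i := by omega
    simp [read, write, h1, h2, hi]

open Primrec in
theorem primrec_read : Primrec fun p : ℕ × List ℕ × ℕ => read p.1 p.2.1 p.2.2 :=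
  option_getD.comp (list_getElem?.comp (fst.comp snd) (snd.comp snd)) fst

open Primrec in
theorem primrec_write :
    Primrec fun p : ℕ × List ℕ × ℕ × ℕ => write p.1 p.2.1 p.2.2.1 p.2.2.2 := by
  have hl : Primrec fun p : ℕ × List ℕ × ℕ × ℕ => p.2.1 := fst.comp snd
  have hh : Primrec fun p : ℕ × List ℕ × ℕ × ℕ => p.2.2.1 := fst.comp (snd.comp snd)
  have hb : Primrec fun p : ℕ × List ℕ × ℕ × ℕ => p.2.2.2 := snd.comp (snd.comp snd)
  have hlen : Primrec fun p : ℕ × List ℕ × ℕ × ℕ => p.2.1.length + p.2.2.1 :=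
    nat_add.comp (list_length.comp hl) hh
  have hrange : Primrec fun p : ℕ × List ℕ × ℕ × ℕ => List.range (p.2.1.length + p.2.2.1 + 1) :=
    list_range.comp (succ.comp hlen)
  have harg : Primrec fun q : (ℕ × List ℕ × ℕ × ℕ) × ℕ => (q.1.1, q.1.2.1, q.2) :=
    pair (fst.comp fst) (pair (hl.comp fst) snd)
  have hread : Primrec fun q : (ℕ × List ℕ × ℕ × ℕ) × ℕ => read q.1.1 q.1.2.1 q.2 := by
    have h := primrec_read.comp harg
    exact h
  have hcell : Primrec₂ fun (p : ℕ × List ℕ × ℕ × ℕ) (i : ℕ) =>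
      if i = p.2.2.1 then p.2.2.2 else read p.1 p.2.1 i :=
    ite (Primrec.eq.comp snd (hh.comp fst)) (hb.comp fst) hread
  exact list_map hrange hcell

theorem primrec_lookup :
    Primrec₂ (List.lookup : ℕ × ℕ → List ((ℕ × ℕ) × ℕ × ℕ × Bool) → Option (ℕ × ℕ × Bool)) := by
  have h : (instBEqProd : BEq (ℕ × ℕ)) = instBEqOfDecidableEq :=
    congrArg BEq.mk (funext₂ fun a b => by
      by_cases hab : a = b
      · subst hab; simp
      · exact (beq_false_of_ne hab).trans (decide_eq_false hab).symm)
  rw [h]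
  exact Primrec.listLookup

/-- The configuration after the move with the given effect. -/
def move (blank : ℕ) (c : Cfg) (r : ℕ × ℕ × Bool) : Option Cfg :=
  bif r.2.2 then some (r.1, write blank c.2.1 c.2.2 r.2.1, c.2.2 + 1)
  else if c.2.2 = 0 then none
  else some (r.1, write blank c.2.1 c.2.2 r.2.1, c.2.2 - 1)

open Primrec in
theorem primrec_move : Primrec fun p : ℕ × Cfg × ℕ × ℕ × Bool => move p.1 p.2.1 p.2.2 := by
  have hc : Primrec fun p : ℕ × Cfg × ℕ × ℕ × Bool => p.2.1 := fst.comp snd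
  have hr : Primrec fun p : ℕ × Cfg × ℕ × ℕ × Bool => p.2.2 := snd.comp snd
  have hh : Primrec fun p : ℕ × Cfg × ℕ × ℕ × Bool => p.2.1.2.2 := snd.comp (snd.comp hc)
  have hw : Primrec fun p : ℕ × Cfg × ℕ × ℕ × Bool => write p.1 p.2.1.2.1 p.2.1.2.2 p.2.2.2.1 := by
    have h := primrec_write.comp
      (pair fst (pair (fst.comp (snd.comp hc)) (pair hh (fst.comp (snd.comp hr)))))
    exact h
  have hcfg : ∀ {h : ℕ × Cfg × ℕ × ℕ × Bool → ℕ}, Primrec h →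
      Primrec fun p : ℕ × Cfg × ℕ × ℕ × Bool =>
        (some (p.2.2.1, write p.1 p.2.1.2.1 p.2.1.2.2 p.2.2.2.1, h p) : Option Cfg) := fun h' =>
    option_some.comp (pair (fst.comp hr) (pair hw h'))
  exact cond (snd.comp (snd.comp hr)) (hcfg (succ.comp hh))
    (ite (Primrec.eq.comp hh (const 0)) (const none) (hcfg (pred.comp hh)))

/-- One move of the machine described by `D`. -/
def step (D : TMDescription) (c : Cfg) : Option Cfg :=
  (D.2.2.2.lookup (c.1, read D.2.1.2 c.2.1 c.2.2)).bind (move D.2.1.2 c)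

/-- The configuration of the machine described by `x.1` after `n` moves on input `x.2`. -/
def run (x : TMDescription × List ℕ) : ℕ → Option Cfg
  | 0 => some (x.1.2.1.1, x.2, 0)
  | n + 1 => (run x n).bind (step x.1)

open Primrec in
theorem primrec_step : Primrec₂ step := by
  have hblank : Primrec fun p : TMDescription × Cfg => p.1.2.1.2 :=
    snd.comp (fst.comp (snd.comp fst))
  have htable : Primrec fun p : TMDescription × Cfg => p.1.2.2.2 :=
    snd.comp (snd.comp (snd.comp fst))
  have hread : Primrec fun p : TMDescription × Cfg => read p.1.2.1.2 p.2.2.1 p.2.2.2 := by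
    have hp : Primrec fun p : TMDescription × Cfg => p.2.2 := snd.comp snd
    have h := primrec_read.comp (pair hblank hp)
    exact h
  have hlookup : Primrec fun p : TMDescription × Cfg =>
      p.1.2.2.2.lookup (p.2.1, read p.1.2.1.2 p.2.2.1 p.2.2.2) :=
    primrec_lookup.comp (pair (fst.comp snd) hread) htable
  have hmove : Primrec₂ fun (p : TMDescription × Cfg) (r : ℕ × ℕ × Bool) =>
      move p.1.2.1.2 p.2 r := by
    have hp : Primrec fun q : (TMDescription × Cfg) × ℕ × ℕ × Bool => (q.1.1.2.1.2, q.1.2, q.2) :=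
      pair (hblank.comp fst) (pair (snd.comp fst) snd)
    have h := primrec_move.comp hp
    exact h
  exact option_bind hlookup hmove

open Primrec in
theorem primrec_run : Primrec₂ run := by
  have hinit : Primrec fun x : TMDescription × List ℕ => (some (x.1.2.1.1, x.2, 0) : Option Cfg) :=
    option_some.comp (pair (fst.comp (fst.comp (snd.comp fst))) (pair snd (const 0)))
  have hnext : Primrec₂ fun (x : TMDescription × List ℕ) (p : ℕ × Option Cfg) =>
      p.2.bind (step x.1) :=
    option_bind (snd.comp snd) (primrec_step.comp (fst.comp (fst.comp fst)) snd)
  refine (nat_rec hinit hnext).of_eq fun x n => ?_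
  induction n with
  | zero => rfl
  | succ n ih => exact congrArg (·.bind (step x.1)) ih

theorem rePred_run_eq_none : REPred fun x => ∃ n, run x n = none := by
  have h : Partrec fun x : TMDescription × List ℕ =>
      Nat.rfind fun n => (Part.some (!(run x n).isSome) : Part Bool) :=
    Partrec.rfind (Primrec.not.comp (Primrec.option_isSome.comp primrec_run)).to_comp.partrec
  exact h.dom_re.of_eq fun x => Nat.rfind_dom.trans (by simp)

end TMDescription

theorem List.lookup_filterMap_map {α β γ δ : Type*} [DecidableEq α] [BEq β] [LawfulBEq β]
    {k : α → β} (hk : Function.Injective k) (f : α → Option γ) (v : γ → δ) (x : α) (L : List α) :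
    (L.filterMap fun y => (f y).map fun r => (k y, v r)).lookup (k x) =
      if x ∈ L then (f x).map v else none := by
  induction L with
  | nil => rfl
  | cons y L ih =>
    rcases hf : f y with - | r
    · rw [List.filterMap_cons_none (by simp [hf]), ih]
      by_cases hxy : x = y
      · subst hxy; simp [hf]
      · simp [hxy]
    · rw [List.filterMap_cons_some (b := (k y, v r)) (by simp [hf]), List.lookup_cons, ih]
      by_cases hxy : x = y
      · subst hxy; simp [hf]
      · have : (k x == k y) = false := by simpa [hk.eq_iff] using hxy
        simp [hxy, this]

namespace TM

theorem haltsOn_iff_run_eq_none {Q Γ : Type} (M : TM Q Γ) (w : List Γ) :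
    M.HaltsOn w ↔ ∃ n, M.run w n = none := by
  constructor
  · rintro ⟨n, c, h, h'⟩
    exact ⟨n + 1, by simp [run, h, h']⟩
  · rintro ⟨n, hn⟩
    induction n with
    | zero => cases hn
    | succ n ih =>
      rcases h : M.run w n with - | c
      · exact ih h
      · exact ⟨n, c, h, by simpa [run, h] using hn⟩

variable {s g : ℕ} (N : TM (Fin s) (Fin g))

theorem lookup_description (q : Fin s) (a : Fin g) :
    N.description.2.2.2.lookup (q.val, a.val) =
      (N.δ q a).map fun r => (r.1.val, r.2.1.val, decide (r.2.2 = Turing.Dir.right)) := by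
  have hk : Function.Injective fun x : Fin s × Fin g => (x.1.val, x.2.val) := fun x y h => by
    simpa [Prod.ext_iff, Fin.ext_iff] using h
  have := List.lookup_filterMap_map hk (fun x : Fin s × Fin g => N.δ x.1 x.2)
    (fun r => (r.1.val, r.2.1.val, decide (r.2.2 = Turing.Dir.right))) (q, a)
    (List.finRange s ×ˢ List.finRange g)
  rw [if_pos (by simp)] at this
  exact this

/-- Numerical and genuine configurations represent each other. -/
def Described (c : TMDescription.Cfg) (d : TMCfg (Fin s) (Fin g)) : Prop :=
  c.1 = d.state.val ∧ (∀ i, TMDescription.read N.blank.val c.2.1 i = (d.tape i).val) ∧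
    c.2.2 = d.head

theorem described_step {c : TMDescription.Cfg} {d : TMCfg (Fin s) (Fin g)}
    (h : N.Described c d) :
    Option.Rel N.Described (TMDescription.step N.description c) (N.step d) := by
  obtain ⟨q, l, n⟩ := c
  obtain ⟨q', T, n'⟩ := d
  obtain ⟨h1, h2, h3⟩ := h
  dsimp only at h1 h2 h3
  subst h1 h3
  have hw : ∀ b : Fin g, ∀ i, TMDescription.read N.blank.val
      (TMDescription.write N.blank.val l n b.val) i = (Function.update T n b i).val := fun b i => by
    rw [TMDescription.read_write, Function.update_apply, h2]
    split_ifs <;> rfl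
  have hb : N.description.2.1.2 = N.blank.val := rfl
  simp only [TMDescription.step, hb, h2, lookup_description, step]
  rcases N.δ q' (T n) with - | ⟨p, b, - | -⟩
  · exact .none
  · by_cases h0 : n = 0
    · subst h0
      exact .none
    · simp only [Option.map_some, Option.bind_some, TMDescription.move, h0, if_false]
      exact .some ⟨rfl, hw b, rfl⟩
  · exact .some ⟨rfl, hw b, rfl⟩

theorem described_run (w : List (Fin g)) (n : ℕ) :
    Option.Rel N.Described (TMDescription.run (N.description, w.map Fin.val) n) (N.run w n) := by
  induction n with
  | zero =>
    refine .some ⟨rfl, fun i => ?_, rfl⟩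
    simp only [TMDescription.read, List.getElem?_map, init, List.getD_eq_getElem?_getD]
    cases w[i]? <;> rfl
  | succ n ih =>
    have h : ∀ a b, Option.Rel N.Described a b → Option.Rel N.Described
        (a.bind (TMDescription.step N.description)) (b.bind N.step) := by
      rintro _ _ (h | -)
      · exact N.described_step h
      · exact .none
    exact h _ _ ih

theorem haltsOn_iff_description (w : List (Fin g)) :
    N.HaltsOn w ↔ ∃ n, TMDescription.run (N.description, w.map Fin.val) n = none := by
  rw [haltsOn_iff_run_eq_none]
  have h : ∀ (a b), Option.Rel N.Described a b → (b = none ↔ a = none) := by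
    rintro _ _ (- | -) <;> simp
  exact exists_congr fun n => h _ _ (N.described_run w n)

end TM

/-! ### Computation paths with a time budget -/

namespace TM

section Path

variable {Q Γ : Type} (M : TM Q Γ)

/-- `M.Path k c φ d ψ`: some moves lead from `c` to `d`; before each of them the head is not to the
left of `c_k` and all cells to the left of `c_k` are blank. The numbers `φ` and `ψ` are budgets of
time before and after these moves, which must not be exceeded by the durations of the moves. -/
inductive Path (k : ℕ) : TMCfg Q Γ → ℝ → TMCfg Q Γ → ℝ → Prop
  | refl (c : TMCfg Q Γ) (φ : ℝ) : Path k c φ c φ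
  | cons {c c' d : TMCfg Q Γ} {φ φ' ψ : ℝ} (hstep : M.step c = some c') (hk : k ≤ c.head)
      (hblank : ∀ j < k, c.tape j = M.blank) (hφ' : 0 ≤ φ') (hφ : φ' + 1 / 2 ^ c.head ≤ φ)
      (h : Path k c' φ' d ψ) : Path k c φ d ψ

variable {M}

theorem Path.trans {k : ℕ} {c d e : TMCfg Q Γ} {φ ψ χ : ℝ} (h : M.Path k c φ d ψ)
    (h' : M.Path k d ψ e χ) : M.Path k c φ e χ := by
  induction h with
  | refl => exact h'
  | cons hstep hk hblank hφ' hφ _ ih => exact .cons hstep hk hblank hφ' hφ (ih h')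

theorem stepTime_eq {w : List Γ} {n : ℕ} {c c' : TMCfg Q Γ} (hc : M.run w n = some c)
    (hstep : M.step c = some c') : M.stepTime w n = ENNReal.ofReal (1 / 2 ^ c.head) := by
  rw [ENNReal.ofReal_div_of_pos (by positivity), ENNReal.ofReal_pow (by norm_num)]
  simp [stepTime, hc, hstep]

theorem Path.run {k : ℕ} {c d : TMCfg Q Γ} {φ ψ : ℝ} (h : M.Path k c φ d ψ) {w : List Γ} {n : ℕ}
    (hc : M.run w n = some c) :
    ∃ n', n ≤ n' ∧ M.run w n' = some d ∧
      ∑ i ∈ Finset.range n', M.stepTime w i + ENNReal.ofReal ψ ≤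
        ∑ i ∈ Finset.range n, M.stepTime w i + ENNReal.ofReal φ ∧
      ∀ i, n ≤ i → i < n' → ∀ e, M.run w i = some e →
        k ≤ e.head ∧ ∀ j < k, e.tape j = M.blank := by
  induction h generalizing n with
  | refl => exact ⟨n, le_rfl, hc, le_rfl, fun i h h' => absurd h' (by omega)⟩
  | @cons c c' d φ φ' ψ hstep hk hblank hφ' hφ _ ih =>
    obtain ⟨n', hn, hd, htime, hinv⟩ := ih (n := n + 1) (by simp [TM.run, hc, hstep])
    refine ⟨n', by omega, hd, htime.trans ?_, fun i hi hi' e he => ?_⟩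
    · rw [Finset.sum_range_succ, stepTime_eq hc hstep, add_assoc, add_comm (ENNReal.ofReal _),
        ← ENNReal.ofReal_add hφ' (by positivity)]
      gcongr
    · rcases hi.eq_or_lt with rfl | hlt
      · obtain rfl : c = e := Option.some.inj (hc.symm.trans he)
        exact ⟨hk, hblank⟩
      · exact hinv i hlt hi' e he

end Path

end TM

/-! ### The machine that shifts its tape while it simulates -/

/-- The phases of a cycle of the simulating machine. The argument is the symbol that was read last
and has still to be written, one cell further to the right. -/
inductive ShiftPhase (Γ : Type) where
  /-- The head is on the left delimiter, or on its way back to it. -/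
  | home : ShiftPhase Γ
  /-- The head is moving right and has not yet met the marked cell. -/
  | before (x : TrackSymbol Γ) : ShiftPhase Γ
  /-- The head has just met the marked cell and the next cell is to be marked. -/
  | mark (x : TrackSymbol Γ) : ShiftPhase Γ
  /-- The marked cell was the last one; a marked blank is to be appended. -/
  | extend : ShiftPhase Γ
  /-- The head is moving right and the mark has been dealt with. -/
  | after (x : TrackSymbol Γ) : ShiftPhase Γ

instance {Γ : Type} [Finite Γ] : Finite (TrackSymbol Γ) :=
  .of_injective (β := Option (Option (Γ × Bool)))
    (fun
      | .blank => none
      | .delim => some none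
      | .cell a t => some (some (a, t)))
    (by rintro (_ | _ | _) (_ | _ | _) h <;> simp_all)

instance {Γ : Type} [Finite Γ] : Finite (ShiftPhase Γ) :=
  .of_injective (β := Bool ⊕ Fin 3 × TrackSymbol Γ)
    (fun
      | .home => .inl false
      | .extend => .inl true
      | .before x => .inr (0, x)
      | .mark x => .inr (1, x)
      | .after x => .inr (2, x))
    (by rintro (_ | _ | _ | _ | _) (_ | _ | _ | _ | _) h <;> simp_all)

namespace TM

variable {Q Γ : Type}

/-- The transition function of the simulating machine. In the sweep to the right each symbol is
carried to the next cell. The move of `U` is carried out when the marked cell is met; as the symbol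
of the preceding cell is written only then, it can still be marked if the head of `U` moves left. -/
def shiftδ (U : TM Q Γ) :
    Q × ShiftPhase Γ → TrackSymbol Γ → Option ((Q × ShiftPhase Γ) × TrackSymbol Γ × Turing.Dir)
  | (q, .home), .delim => some ((q, .before .delim), .blank, .right)
  | (q, .home), .cell a t => some ((q, .home), .cell a t, .left)
  | (q, .before x), .cell a false => some ((q, .before (.cell a false)), x, .right)
  | (q, .before x), .cell a true =>
    match U.δ q a, x with
    | some (p, b, .right), x => some ((p, .mark (.cell b false)), x, .right)
    | some (p, b, .left), .cell a' _ => some ((p, .after (.cell b false)), .cell a' true, .right)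
    | _, _ => none
  | (q, .mark x), .cell a _ => some ((q, .after (.cell a true)), x, .right)
  | (q, .mark x), _ => some ((q, .extend), x, .right)
  | (q, .extend), _ => some ((q, .after .delim), .cell U.blank true, .right)
  | (q, .after x), .blank => some ((q, .home), x, .left)
  | (q, .after x), y => some ((q, .after y), x, .right)
  | _, _ => none

/-- The machine that simulates `U` in cycles and shifts the tape content by one cell in each. -/
noncomputable def shiftMachine (U : TM Q Γ) [Finite Γ] : TM (Q × ShiftPhase Γ) (TrackSymbol Γ) where
  inputSymbols := (Set.toFinite {.blank}ᶜ).toFinset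
  blank := .blank
  blank_notMem := by simp
  start := (U.start, .home)
  final := U.final ×ˢ (Set.toFinite Set.univ).toFinset
  δ := U.shiftδ

section shiftedTape

variable {k m : ℕ} {c : TMCfg Q Γ} {j : ℕ}

theorem shiftedTape_of_lt (h : j < k) : shiftedTape k m c j = .blank := by simp [shiftedTape, h]

theorem shiftedTape_self : shiftedTape k m c k = .delim := by simp [shiftedTape]

theorem shiftedTape_cell (h : j < m) :
    shiftedTape k m c (k + 1 + j) = .cell (c.tape j) (decide (j = c.head)) := by
  have h1 : ¬ k + 1 + j < k := by omega
  have h2 : k + 1 + j ≠ k := by omega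
  simp [shiftedTape, h1, h2, h]

theorem shiftedTape_end : shiftedTape k m c (k + 1 + m) = .delim := by
  have h1 : ¬ k + 1 + m < k := by omega
  have h2 : k + 1 + m ≠ k := by omega
  simp [shiftedTape, h1, h2]

theorem shiftedTape_of_gt (h : k + 1 + m < j) : shiftedTape k m c j = .blank := by
  have h1 : ¬ j < k := by omega
  have h2 : j ≠ k := by omega
  have h3 : ¬ j < k + 1 + m := by omega
  have h4 : j ≠ k + 1 + m := by omega
  simp [shiftedTape, h1, h2, h3, h4]

end shiftedTape

/-- The symbol that is carried to `c_(k+1+r)` in cycle `k`, as long as the marked cell has not been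
met: the left delimiter, or the unmarked symbol of the preceding cell. -/
def carried (c : TMCfg Q Γ) : ℕ → TrackSymbol Γ
  | 0 => .delim
  | r + 1 => .cell (c.tape r) false

theorem shiftedTape_eq_carried {k m : ℕ} {c c' : TMCfg Q Γ} {r : ℕ} (hr : r ≤ m)
    (h : ∀ i < r, c'.tape i = c.tape i ∧ i ≠ c'.head) :
    shiftedTape (k + 1) m c' (k + 1 + r) = carried c r := by
  cases r with
  | zero => exact shiftedTape_self
  | succ r =>
    obtain ⟨h1, h2⟩ := h r (by omega)
    rw [show k + 1 + (r + 1) = k + 1 + 1 + r by omega, shiftedTape_cell (by omega), h1, carried,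
      decide_eq_false h2]

/-- The tape in the course of a sweep to the right: its part to the left of `c_j` has been replaced
by that of `new`. -/
def splice {Γ : Type} (new old : ℕ → Γ) (j i : ℕ) : Γ := if i < j then new i else old i

theorem update_splice {Γ : Type} (new old : ℕ → Γ) (j : ℕ) :
    Function.update (splice new old j) j (new j) = splice new old (j + 1) := by
  funext i
  simp only [Function.update_apply, splice]
  by_cases h : i = j
  · simp [h]
  · simp only [h, if_false]
    congr 1
    exact propext (by omega)

variable (U : TM Q Γ) [Finite Γ] {k : ℕ}

/-- One move of a sweep to the right. The budget at `c_j` covers the rest of the sweep, whose moves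
take at most `2 / 2 ^ j` units of time, and `3 / 2 ^ k` units for the sweep back and all later
cycles. -/
theorem path_right {s s' : Q × ShiftPhase Γ} {old new : ℕ → TrackSymbol Γ} {j : ℕ}
    (hδ : U.shiftδ s (old j) = some (s', new j, .right)) (hk : k ≤ j)
    (hnew : ∀ i < k, new i = .blank) :
    U.shiftMachine.Path k ⟨s, splice new old j, j⟩ (2 / 2 ^ j + 3 / 2 ^ k)
      ⟨s', splice new old (j + 1), j + 1⟩ (2 / 2 ^ (j + 1) + 3 / 2 ^ k) := by
  refine .cons ?_ hk (fun i hi => ?_) (by positivity) (le_of_eq ?_) (.refl _ _)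
  · have : splice new old j j = old j := by simp [splice]
    simp only [step, this]
    rw [show U.shiftMachine.δ = U.shiftδ from rfl, hδ]
    simp only [update_splice]
  · simp only [splice, show i < j by omega, if_true]
    exact hnew i hi
  · simp only
    rw [pow_succ]
    field_simp
    ring

/-- The sweep back to the left delimiter. Its moves leave `c_(k+1+r)`, …, `c_(k+2)`, and the
budget is the sum of their durations and of the `5 / 2 ^ (k + 1)` units for the later cycles. -/
theorem path_left (p : Q) (m : ℕ) (c : TMCfg Q Γ) (r : ℕ) (hr : r ≤ m) :
    U.shiftMachine.Path k ⟨(p, .home), shiftedTape (k + 1) m c, k + 1 + r⟩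
      (3 / 2 ^ k - 1 / 2 ^ (k + 1 + r))
      ⟨(p, .home), shiftedTape (k + 1) m c, k + 1⟩ (5 / 2 ^ (k + 1)) := by
  induction r with
  | zero =>
    have : (3 / 2 ^ k - 1 / 2 ^ (k + 1 + 0) : ℝ) = 5 / 2 ^ (k + 1) := by
      rw [add_zero, pow_succ]
      field_simp
      ring
    rw [this]
    exact .refl _ _
  | succ r ih =>
    refine .cons ?_ (by simp only; omega) (fun i hi => shiftedTape_of_lt (by omega)) ?_
      (le_of_eq ?_) (ih (by omega))
    · have hread : shiftedTape (k + 1) m c (k + 1 + (r + 1)) =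
          .cell (c.tape r) (decide (r = c.head)) := by
        rw [← shiftedTape_cell (k := k + 1) (m := m) (by omega)]
        congr 1
        omega
      simp only [step, hread]
      rw [show U.shiftMachine.δ = U.shiftδ from rfl, shiftδ]
      simp [← hread, ← add_assoc]
    · have : (1 / 2 ^ (k + 1 + r) : ℝ) ≤ 3 / 2 ^ k := by
        rw [add_assoc, pow_add]
        have : (1 : ℝ) ≤ 2 ^ (1 + r) := one_le_pow₀ (by norm_num)
        rw [div_le_div_iff₀ (by positivity) (by positivity)]
        nlinarith [pow_pos (two_pos : (0 : ℝ) < 2) k]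
      linarith
    · simp only
      rw [← add_assoc, pow_succ _ (k + 1 + r)]
      field_simp
      ring

/-- The sweep to the right up to a cell not to the right of the marked one. -/
theorem path_before {m : ℕ} {c : TMCfg Q Γ} (hm : c.head < m) {new : ℕ → TrackSymbol Γ}
    (hnew : ∀ i ≤ k, new i = .blank) (hnew' : ∀ r < c.head, new (k + 1 + r) = carried c r)
    (r : ℕ) (hr : r ≤ c.head) :
    U.shiftMachine.Path k ⟨(c.state, .home), shiftedTape k m c, k⟩ (5 / 2 ^ k)
      ⟨(c.state, .before (carried c r)), splice new (shiftedTape k m c) (k + 1 + r), k + 1 + r⟩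
      (2 / 2 ^ (k + 1 + r) + 3 / 2 ^ k) := by
  induction r with
  | zero =>
    have h0 : splice new (shiftedTape k m c) k = shiftedTape k m c := by
      funext i
      by_cases hi : i < k
      · simp [splice, hi, hnew i hi.le, shiftedTape_of_lt]
      · simp [splice, hi]
    have h := U.path_right (s := (c.state, .home)) (s' := (c.state, .before .delim))
      (old := shiftedTape k m c) (new := new) (j := k) (k := k)
      (by rw [shiftedTape_self, hnew k le_rfl]; rfl) le_rfl fun i hi => hnew i hi.le
    rw [h0, ← add_div] at h
    norm_num at h
    exact h
  | succ r ih =>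
    refine (ih (by omega)).trans (U.path_right (s := (c.state, .before (carried c r)))
      (s' := (c.state, .before (carried c (r + 1)))) ?_ (by omega) fun i hi => hnew i hi.le)
    have : decide (r = c.head) = false := decide_eq_false (by omega)
    rw [shiftedTape_cell (by omega), this, hnew' r (by omega)]
    rfl

/-- The sweep to the right after the mark has been dealt with, the turn, and the sweep back. -/
theorem path_after {m m' : ℕ} {c c' : TMCfg Q Γ} (p : Q) (hm : m ≤ m') {j : ℕ} (hj : k ≤ j)
    (hj' : j ≤ k + 2 + m') (h : ∀ i, j ≤ i → i < k + 2 + m' →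
      shiftedTape k m c i ≠ .blank ∧ shiftedTape k m c i = shiftedTape (k + 1) m' c' (i + 1)) :
    U.shiftMachine.Path k
      ⟨(p, .after (shiftedTape (k + 1) m' c' j)),
        splice (shiftedTape (k + 1) m' c') (shiftedTape k m c) j, j⟩ (2 / 2 ^ j + 3 / 2 ^ k)
      ⟨(p, .home), shiftedTape (k + 1) m' c', k + 1⟩ (5 / 2 ^ (k + 1)) := by
  obtain ⟨r, hr⟩ := Nat.exists_eq_add_of_le hj'
  induction r generalizing j with
  | zero =>
    obtain rfl : j = k + 2 + m' := by omega
    have hend : shiftedTape (k + 1) m' c' (k + 2 + m') = .delim := by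
      rw [show k + 2 + m' = k + 1 + 1 + m' by omega, shiftedTape_end]
    have hturn : splice (shiftedTape (k + 1) m' c') (shiftedTape k m c) (k + 2 + m' + 1) =
        shiftedTape (k + 1) m' c' := by
      funext i
      by_cases hi : i < k + 2 + m' + 1
      · simp [splice, hi]
      · simp only [splice, hi, if_false]
        rw [shiftedTape_of_gt (by omega), shiftedTape_of_gt (by omega)]
    refine .cons (φ' := 3 / 2 ^ k - 1 / 2 ^ (k + 1 + m')) ?_ (by simp only; omega)
      (fun i hi => ?_) ?_ ?_ (U.path_left p m' c' m' le_rfl)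
    · have hread : splice (shiftedTape (k + 1) m' c') (shiftedTape k m c) (k + 2 + m')
          (k + 2 + m') = .blank := by
        simp only [splice, lt_irrefl, if_false]
        exact shiftedTape_of_gt (by omega)
      have h0 : k + 2 + m' ≠ 0 := by omega
      have h1 : k + 2 + m' - 1 = k + 1 + m' := by omega
      have hupdate := update_splice (shiftedTape (k + 1) m' c') (shiftedTape k m c) (k + 2 + m')
      rw [hend, hturn] at hupdate
      simp only [step, hread, hend]
      rw [show U.shiftMachine.δ = U.shiftδ from rfl, shiftδ]
      simp only [hupdate, h0, h1, if_false]
    · simp only [splice, show i < k + 2 + m' by omega, if_true]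
      exact shiftedTape_of_lt (by omega)
    · have : (1 / 2 ^ (k + 1 + m') : ℝ) ≤ 3 / 2 ^ k := by
        rw [add_assoc, pow_add]
        have : (1 : ℝ) ≤ 2 ^ (1 + m') := one_le_pow₀ (by norm_num)
        rw [div_le_div_iff₀ (by positivity) (by positivity)]
        nlinarith [pow_pos (two_pos : (0 : ℝ) < 2) k]
      linarith
    · simp only
      have h1 : (0 : ℝ) ≤ 1 / 2 ^ (k + 1 + m') := by positivity
      have h2 : (0 : ℝ) ≤ 1 / 2 ^ (k + 2 + m') := by positivity
      have h3 : (2 / 2 ^ (k + 2 + m') : ℝ) = 1 / 2 ^ (k + 2 + m') + 1 / 2 ^ (k + 2 + m') := by ring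
      linarith
  | succ r ih =>
    obtain ⟨hne, heq⟩ := h j le_rfl (by omega)
    refine (U.path_right (s' := (p, .after (shiftedTape (k + 1) m' c' (j + 1)))) ?_ hj
      fun i hi => shiftedTape_of_lt (by omega)).trans
        (ih (by omega) (by omega) (fun i hi hi' => h i (by omega) hi') (by omega))
    rw [← heq]
    revert hne
    cases shiftedTape k m c j <;> intro hne
    · exact absurd rfl hne
    · rfl
    · rfl

variable {U}

/-- A cycle of the simulating machine performs one move of `U`. -/
theorem path_cycle {m : ℕ} {c c' : TMCfg Q Γ} (hm : c.head < m)
    (hblank : ∀ i, m ≤ i → c.tape i = U.blank) (hstep : U.step c = some c') :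
    ∃ m', c'.head < m' ∧ (∀ i, m' ≤ i → c'.tape i = U.blank) ∧
      U.shiftMachine.Path k ⟨(c.state, .home), shiftedTape k m c, k⟩ (5 / 2 ^ k)
        ⟨(c'.state, .home), shiftedTape (k + 1) m' c', k + 1⟩ (5 / 2 ^ (k + 1)) := by
  obtain ⟨q, T, h⟩ := c
  dsimp only at hm hblank
  have hmarked : shiftedTape k m ⟨q, T, h⟩ (k + 1 + h) = .cell (T h) true := by
    rw [shiftedTape_cell hm]
    simp
  rcases hδ : U.δ q (T h) with - | ⟨p, b, - | -⟩
  · simp [step, hδ] at hstep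
  · -- The head of `U` moves left, so the cell before the marked one is to be marked.
    rcases h with - | h
    · simp [step, hδ] at hstep
    obtain rfl : ⟨p, Function.update T (h + 1) b, h⟩ = c' := by simpa [step, hδ] using hstep
    refine ⟨m, by simp only; omega, fun i hi => ?_, ?_⟩
    · simp only [Function.update_of_ne (show i ≠ h + 1 by omega)]
      exact hblank i hi
    refine (U.path_before (new := shiftedTape (k + 1) m ⟨p, Function.update T (h + 1) b, h⟩) hm
      (fun i hi => shiftedTape_of_lt (by omega)) (fun r hr => ?_) (h + 1) le_rfl).trans
        (.trans (U.path_right (j := k + 1 + (h + 1)) (s' := (p, .after (.cell b false))) ?_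
          (by omega) fun i hi => shiftedTape_of_lt (by omega)) ?_)
    · dsimp only at hr
      exact shiftedTape_eq_carried (by omega) fun i hi =>
        ⟨Function.update_of_ne (by omega) _ _, by simp only; omega⟩
    · rw [hmarked, show k + 1 + (h + 1) = k + 1 + 1 + h by omega, shiftedTape_cell (by omega)]
      simp [shiftδ, hδ, carried]
    · have hnext : TrackSymbol.cell b false = shiftedTape (k + 1) m
          ⟨p, Function.update T (h + 1) b, h⟩ (k + 1 + (h + 1) + 1) := by
        rw [show k + 1 + (h + 1) + 1 = k + 1 + 1 + (h + 1) by omega, shiftedTape_cell hm]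
        simp
      rw [hnext]
      refine U.path_after p le_rfl (by omega) (by omega) fun i hi hi' => ?_
      obtain ⟨r, rfl⟩ := Nat.exists_eq_add_of_le (show k + 1 ≤ i by omega)
      rw [show k + 1 + r + 1 = k + 1 + 1 + r by omega]
      rcases (show r ≤ m by omega).lt_or_eq with hr | rfl
      · rw [shiftedTape_cell hr, shiftedTape_cell hr]
        have h1 : r ≠ h + 1 := by omega
        have h2 : r ≠ h := by omega
        simp [h1, h2]
      · rw [shiftedTape_end, shiftedTape_end]
        simp
  · -- The head of `U` moves right, so the cell after the marked one is to be marked.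
    obtain rfl : ⟨p, Function.update T h b, h + 1⟩ = c' := by simpa [step, hδ] using hstep
    refine ⟨max m (h + 2), by simp, fun i hi => ?_, ?_⟩
    · simp only [Function.update_of_ne (show i ≠ h by omega)]
      exact hblank i (by omega)
    refine (U.path_before (new := shiftedTape (k + 1) (max m (h + 2))
      ⟨p, Function.update T h b, h + 1⟩) hm (fun i hi => shiftedTape_of_lt (by omega))
      (fun r hr => ?_) h le_rfl).trans
        (.trans (U.path_right (j := k + 1 + h) (s' := (p, .mark (.cell b false))) ?_ (by omega)
          fun i hi => shiftedTape_of_lt (by omega)) ?_)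
    · dsimp only at hr
      exact shiftedTape_eq_carried (by omega) fun i hi =>
        ⟨Function.update_of_ne (by omega) _ _, by simp only; omega⟩
    · rw [hmarked, shiftedTape_eq_carried (c := ⟨q, T, h⟩) (by omega) fun i hi =>
        ⟨Function.update_of_ne (by omega) _ _, by simp only; omega⟩]
      simp [shiftδ, hδ]
    have hwrite : shiftedTape (k + 1) (max m (h + 2)) ⟨p, Function.update T h b, h + 1⟩
        (k + 1 + h + 1) = .cell b false := by
      rw [show k + 1 + h + 1 = k + 1 + 1 + h by omega, shiftedTape_cell (by omega)]
      simp
    have hmark : shiftedTape (k + 1) (max m (h + 2)) ⟨p, Function.update T h b, h + 1⟩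
        (k + 1 + h + 1 + 1) = .cell (T (h + 1)) true := by
      rw [show k + 1 + h + 1 + 1 = k + 1 + 1 + (h + 1) by omega, shiftedTape_cell (by omega)]
      simp
    rcases (show h + 1 ≤ m by omega).lt_or_eq with hlt | rfl
    · obtain hmax : max m (h + 2) = m := by omega
      rw [hmax] at hwrite hmark ⊢
      refine .trans (U.path_right (s' := (p, .after (.cell (T (h + 1)) true))) ?_ (by omega)
        fun i hi => shiftedTape_of_lt (by omega)) ?_
      · rw [show k + 1 + h + 1 = k + 1 + (h + 1) by omega] at hwrite ⊢
        rw [hwrite, shiftedTape_cell hlt]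
        rfl
      · rw [← hmark]
        refine U.path_after p le_rfl (by omega) (by omega) fun i hi hi' => ?_
        obtain ⟨r, rfl⟩ := Nat.exists_eq_add_of_le (show k + 1 ≤ i by omega)
        rw [show k + 1 + r + 1 = k + 1 + 1 + r by omega]
        rcases (show r ≤ m by omega).lt_or_eq with hr | rfl
        · rw [shiftedTape_cell hr, shiftedTape_cell hr]
          have h1 : r ≠ h + 1 := by omega
          have h2 : r ≠ h := by omega
          simp [h1, h2]
        · rw [shiftedTape_end, shiftedTape_end]
          simp
    · obtain hmax : max (h + 1) (h + 2) = h + 2 := by omega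
      rw [hmax] at hwrite hmark ⊢
      rw [hblank _ le_rfl] at hmark
      refine .trans (U.path_right (s' := (p, .extend)) ?_ (by omega)
        fun i hi => shiftedTape_of_lt (by omega)) (.trans
          (U.path_right (s' := (p, .after .delim)) ?_ (by omega) fun i hi => shiftedTape_of_lt (by omega)) ?_)
      · rw [hwrite, show k + 1 + h + 1 = k + 1 + (h + 1) by omega, shiftedTape_end]
        rfl
      · rw [hmark]
        simp [shiftδ]
      · have hend : shiftedTape (k + 1) (h + 2) ⟨p, Function.update T h b, h + 1⟩
            (k + 1 + h + 1 + 1 + 1) = .delim := by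
          rw [show k + 1 + h + 1 + 1 + 1 = k + 1 + 1 + (h + 2) by omega, shiftedTape_end]
        rw [← hend]
        exact U.path_after p (by omega) (by omega) (by omega) fun i hi hi' => by omega

/-- If `U` has no next move, the simulating machine halts in the course of the cycle. -/
theorem path_halt {m : ℕ} {c : TMCfg Q Γ} (hm : c.head < m) (hstep : U.step c = none) :
    ∃ e ψ, U.shiftMachine.Path k ⟨(c.state, .home), shiftedTape k m c, k⟩ (5 / 2 ^ k) e ψ ∧
      U.shiftMachine.step e = none ∧ (e.state ∈ U.shiftMachine.final ↔ c.state ∈ U.final) := by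
  refine ⟨_, _, U.path_before (new := shiftedTape (k + 1) m c) hm
    (fun i hi => shiftedTape_of_lt (by omega)) (fun r hr => ?_) c.head le_rfl, ?_, ?_⟩
  · exact shiftedTape_eq_carried (by omega) fun i hi => ⟨rfl, by omega⟩
  · have hread : splice (shiftedTape (k + 1) m c) (shiftedTape k m c) (k + 1 + c.head)
        (k + 1 + c.head) = .cell (c.tape c.head) true := by
      simp [splice, shiftedTape_cell hm]
    have hnone : U.shiftδ (c.state, .before (carried c c.head)) (.cell (c.tape c.head) true) =
        none := by
      rcases hδ : U.δ c.state (c.tape c.head) with - | ⟨p, b, - | -⟩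
      · simp only [shiftδ, hδ]
      · have h0 : c.head = 0 := by simpa [step, hδ] using hstep
        simp only [shiftδ, hδ]
        simp only [h0, carried]
      · simp [step, hδ] at hstep
    simp only [step, hread]
    rw [show U.shiftMachine.δ = U.shiftδ from rfl, hnone]
  · simp [shiftMachine]

end TM

/-! ### Cycles, halting and the total time -/

namespace TM

variable {Q Γ : Type}

theorem run_eq_some_of_le (M : TM Q Γ) {w : List Γ} {m n : ℕ} (h : m ≤ n) {c : TMCfg Q Γ}
    (hc : M.run w n = some c) : ∃ d, M.run w m = some d := by
  induction n, h using Nat.le_induction generalizing c with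
  | base => exact ⟨c, hc⟩
  | succ n _ ih =>
    obtain ⟨d, hd, -⟩ := Option.bind_eq_some_iff.1 hc
    exact ih hd

theorem stepTime_eq_zero_of_halt (M : TM Q Γ) {w : List Γ} {n i : ℕ} {c : TMCfg Q Γ}
    (hc : M.run w n = some c) (hstep : M.step c = none) (h : n ≤ i) : M.stepTime w i = 0 := by
  rcases h.eq_or_lt with rfl | h
  · simp [stepTime, hc, hstep]
  · have : M.run w i = none := by
      by_contra hne
      obtain ⟨d, hd⟩ := Option.ne_none_iff_exists'.1 hne
      obtain ⟨e, he⟩ := M.run_eq_some_of_le (Nat.succ_le_of_lt h) hd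
      simp [run, hc, hstep] at he
    simp [stepTime, this]

theorem vanishesOn_of_forall_exists (M : TM Q Γ) {w : List Γ}
    (hrun : ∀ n, M.run w n ≠ none)
    (h : ∀ k, ∃ N, ∀ n, N ≤ n → ∀ c, M.run w n = some c →
      k ≤ c.head ∧ ∀ j < k, c.tape j = M.blank) : M.VanishesOn w := by
  refine ⟨hrun, fun i => ?_⟩
  obtain ⟨N, hN⟩ := h (i + 1)
  exact ⟨N, fun n hn c hc => ⟨(hN n hn c hc).1, (hN n hn c hc).2 i (Nat.lt_succ_self i)⟩⟩

variable (U : TM Q Γ) [Finite Γ]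

theorem represents_init (w : List Γ) :
    U.Represents (fun q => (q, ShiftPhase.home)) 0 (U.init w)
      (U.shiftMachine.init (U.frame w)) := by
  refine ⟨rfl, rfl, max 1 w.length, by simp [init], fun i hi => ?_, ?_⟩
  · simp only [init]
    rw [List.getD_eq_default]
    omega
  funext i
  change (U.frame w).getD i .blank = _
  rcases i with - | i
  · exact shiftedTape_self.symm
  rw [add_comm, ← zero_add 1]
  rcases w with - | ⟨a, l⟩
  · rcases i with - | - | i
    · rw [shiftedTape_cell (by simp)]
      simp [frame, init]
    · exact (shiftedTape_end (k := 0) (m := 1)).symm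
    · rw [shiftedTape_of_gt (by simp; omega), List.getD_eq_default]
      simp [frame]
      omega
  · have hmax : max 1 (a :: l).length = l.length + 1 := by simp
    rw [hmax]
    rcases i with - | i
    · rw [shiftedTape_cell (by omega)]
      simp [frame, init]
    · rw [show 0 + 1 + (i + 1) = i + 2 by omega]
      have hframe : (U.frame (a :: l)).getD (i + 2) .blank =
          (l.map (fun b => TrackSymbol.cell b false) ++ [TrackSymbol.delim]).getD i .blank := by
        simp [frame]
      rw [hframe, show i + 2 = 0 + 1 + (i + 1) by omega]
      rcases lt_trichotomy i l.length with hi | rfl | hi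
      · rw [shiftedTape_cell (by omega), List.getD_append _ _ _ _ (by simpa using hi)]
        simp [init, hi]
      · rw [shiftedTape_end]
        simp
      · rw [shiftedTape_of_gt (by omega), List.getD_eq_default]
        simpa using hi

/-- Cycle `k` of the simulating machine starts after `n` moves, and at most `5 / 2 ^ k` units of the
total of `5` units of time are left. -/
def CycleStart (w : List Γ) (k n : ℕ) : Prop :=
  ∀ c, U.run w k = some c →
    (∃ d, U.shiftMachine.run (U.frame w) n = some d ∧
      U.Represents (fun q => (q, ShiftPhase.home)) k c d) ∧
    ∑ i ∈ Finset.range n, U.shiftMachine.stepTime (U.frame w) i + ENNReal.ofReal (5 / 2 ^ k) ≤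
      ENNReal.ofReal 5

theorem cycleStart_zero (w : List Γ) : U.CycleStart w 0 0 := by
  rintro c ⟨⟩
  exact ⟨⟨_, rfl, U.represents_init w⟩, by simp⟩

variable {U}

/-- Once `U` has halted, the starting times of the cycles carry no information and are merely chosen
to be increasing. -/
theorem CycleStart.next {w : List Γ} {k n : ℕ} (h : U.CycleStart w k n) :
    ∃ n', U.CycleStart w (k + 1) n' ∧ n < n' ∧ ∀ c', U.run w (k + 1) = some c' →
      ∀ i, n ≤ i → i < n' → ∀ e, U.shiftMachine.run (U.frame w) i = some e →
        k ≤ e.head ∧ ∀ j < k, e.tape j = .blank := by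
  rcases hrun : U.run w (k + 1) with - | c'
  · exact ⟨n + 1, fun c hc => by simp [hrun] at hc, by omega, fun c' hc' => by simp at hc'⟩
  obtain ⟨c, hc, hstep⟩ := Option.bind_eq_some_iff.1 hrun
  obtain ⟨⟨⟨s, T, i⟩, hd, rfl, rfl, m, hm, hblank, hT⟩, htime⟩ := h c hc
  dsimp only at hT
  subst hT
  obtain ⟨m', hm', hblank', hpath⟩ := path_cycle (k := i) hm hblank hstep
  obtain ⟨n', hn, hd', htime', hinv⟩ := hpath.run hd
  refine ⟨n', fun c'' hc'' => ?_, hn.lt_of_ne ?_, fun _ _ => hinv⟩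
  · obtain rfl : c' = c'' := Option.some.inj (hrun.symm.trans hc'')
    exact ⟨⟨_, hd', rfl, rfl, m', hm', hblank', rfl⟩, htime'.trans htime⟩
  · rintro rfl
    have := congrArg TMCfg.head (Option.some.inj (hd.symm.trans hd'))
    simp at this

theorem CycleStart.halt {w : List Γ} {k n : ℕ} (h : U.CycleStart w k n) {c : TMCfg Q Γ}
    (hc : U.run w k = some c) (hstep : U.step c = none) :
    ∃ n' e, n ≤ n' ∧ U.shiftMachine.run (U.frame w) n' = some e ∧ U.shiftMachine.step e = none ∧
      (e.state ∈ U.shiftMachine.final ↔ c.state ∈ U.final) ∧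
      ∑ i ∈ Finset.range n', U.shiftMachine.stepTime (U.frame w) i ≤ ENNReal.ofReal 5 := by
  obtain ⟨⟨⟨s, T, i⟩, hd, rfl, rfl, m, hm, hblank, hT⟩, htime⟩ := h c hc
  dsimp only at hT
  subst hT
  obtain ⟨e, ψ, hpath, he, hfinal⟩ := path_halt (k := i) hm hstep
  obtain ⟨n', hn, he', htime', -⟩ := hpath.run hd
  exact ⟨n', e, hn, he', he, hfinal, le_self_add.trans (htime'.trans htime)⟩

variable (U)

/-- The starting times of the cycles. In cycle `k` the head is never to the left of `c_k`, and all
cells to the left of `c_k` are blank. -/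
theorem exists_cycleStart (w : List Γ) :
    ∃ t : ℕ → ℕ, t 0 = 0 ∧ StrictMono t ∧ (∀ k, U.CycleStart w k (t k)) ∧
      ∀ k c', U.run w (k + 1) = some c' → ∀ i, t k ≤ i → i < t (k + 1) →
        ∀ e, U.shiftMachine.run (U.frame w) i = some e →
          k ≤ e.head ∧ ∀ j < k, e.tape j = .blank := by
  choose f hf using fun k (n : {n // U.CycleStart w k n}) => n.2.next
  let t : ∀ k, {n // U.CycleStart w k n} :=
    Nat.rec ⟨0, U.cycleStart_zero w⟩ fun k n => ⟨f k n, (hf k n).1⟩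
  exact ⟨fun k => (t k).1, rfl, strictMono_nat_of_lt_succ fun k => (hf k (t k)).2.1,
    fun k => (t k).2, fun k => (hf k (t k)).2.2⟩

theorem shiftSimulates_shiftMachine : U.shiftMachine.ShiftSimulates U := by
  refine ⟨fun q => (q, .home), fun p q h => (Prod.ext_iff.1 h).1, fun w _ => ?_⟩
  obtain ⟨t, h0, ht, hstart, -⟩ := U.exists_cycleStart w
  refine ⟨t, h0, ht, fun k c hc => ⟨((hstart k) c hc).1, fun hstep => ?_⟩⟩
  obtain ⟨n, e, hn, he, he', hfinal, -⟩ := (hstart k).halt hc hstep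
  exact ⟨n, e, hn, he, he', hfinal⟩

theorem shiftMachine_totalTime_le (w : List Γ) :
    U.shiftMachine.totalTime (U.frame w) ≤ ENNReal.ofReal 5 := by
  obtain ⟨t, -, ht, hstart, -⟩ := U.exists_cycleStart w
  by_cases hU : U.HaltsOn w
  · obtain ⟨k, c, hc, hstep⟩ := hU
    obtain ⟨n, e, -, he, he', -, htime⟩ := (hstart k).halt hc hstep
    rw [totalTime, tsum_eq_sum (s := Finset.range n)]
    · exact htime
    · intro i hi
      exact stepTime_eq_zero_of_halt _ he he' (by simpa using hi)
  · rw [haltsOn_iff_run_eq_none] at hU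
    push Not at hU
    rw [totalTime, ENNReal.tsum_eq_iSup_nat]
    refine iSup_le fun n => ?_
    obtain ⟨c, hc⟩ := Option.ne_none_iff_exists'.1 (hU n)
    calc ∑ i ∈ Finset.range n, U.shiftMachine.stepTime (U.frame w) i
        ≤ ∑ i ∈ Finset.range (t n), U.shiftMachine.stepTime (U.frame w) i :=
          Finset.sum_le_sum_of_subset (Finset.range_mono ht.le_apply)
      _ ≤ ENNReal.ofReal 5 := le_self_add.trans ((hstart n) c hc).2

theorem shiftMachine_haltsOn {w : List Γ} (h : U.HaltsOn w) :
    U.shiftMachine.HaltsOn (U.frame w) := by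
  obtain ⟨t, -, -, hstart, -⟩ := U.exists_cycleStart w
  obtain ⟨k, c, hc, hstep⟩ := h
  obtain ⟨n, e, -, he, he', -⟩ := (hstart k).halt hc hstep
  exact ⟨n, e, he, he'⟩

theorem shiftMachine_vanishesOn {w : List Γ} (h : ¬ U.HaltsOn w) :
    U.shiftMachine.VanishesOn (U.frame w) := by
  obtain ⟨t, -, ht, hstart, hinv⟩ := U.exists_cycleStart w
  rw [haltsOn_iff_run_eq_none] at h
  push Not at h
  have hU : ∀ k, ∃ c, U.run w k = some c := fun k => Option.ne_none_iff_exists'.1 (h k)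
  refine vanishesOn_of_forall_exists _ (fun n => ?_) fun k => ⟨t k, fun n hn e he => ?_⟩
  · obtain ⟨c, hc⟩ := hU n
    obtain ⟨⟨d, hd, -⟩, -⟩ := hstart n c hc
    obtain ⟨e, he⟩ := run_eq_some_of_le _ ht.le_apply hd
    simp [he]
  · -- Move `n` belongs to some cycle `l`, and `k ≤ l`.
    obtain ⟨l, hkl, hl, hl'⟩ : ∃ l, k ≤ l ∧ t l ≤ n ∧ n < t (l + 1) := by
      have hex : ∃ l, n < t (l + 1) := ⟨n, (Nat.lt_succ_self n).trans_le ht.le_apply⟩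
      classical
      refine ⟨Nat.find hex, ?_, ?_, Nat.find_spec hex⟩
      · have : k < Nat.find hex + 1 := ht.lt_iff_lt.1 (hn.trans_lt (Nat.find_spec hex))
        omega
      · rcases h0 : Nat.find hex with - | l
        · exact (ht.monotone (Nat.zero_le k)).trans hn
        · exact not_lt.1 (Nat.find_min hex (h0 ▸ Nat.lt_succ_self l))
    obtain ⟨c', hc'⟩ := hU (l + 1)
    obtain ⟨h1, h2⟩ := hinv l c' hc' n hl hl' e he
    exact ⟨hkl.trans h1, fun j hj => h2 j (hj.trans_le hkl)⟩

theorem shiftMachine_answersBefore (w : List Γ) :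
    U.shiftMachine.AnswersBefore 18 (U.frame w) (U.HaltsOn w) := by
  refine ⟨fun a ha => ?_, (U.shiftMachine_totalTime_le w).trans_lt ?_, U.shiftMachine_haltsOn,
    U.shiftMachine_vanishesOn⟩
  · have : a ≠ .blank := by
      rintro rfl
      cases w <;> simp [frame] at ha
    simpa [shiftMachine] using this
  · rw [ENNReal.ofReal_ofNat]
    norm_num

end TM

/-! ### Encodings and undecidability -/

theorem ComputableEncoding.frame {α Q Γ : Type} [Primcodable α] {code : α → List Γ} (U : TM Q Γ)
    (h : ComputableEncoding code) : ComputableEncoding fun x => U.frame (code x) := by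
  obtain ⟨g, e, he⟩ := h
  have : Finite Γ := .of_equiv _ e.symm
  obtain ⟨g', ⟨e'⟩⟩ := Finite.exists_equiv_fin (TrackSymbol Γ)
  refine ⟨g', e', ?_⟩
  let f : Bool → Fin g → Fin g' := fun t a => e' (.cell (e.symm a) t)
  have hmatch : Primrec fun l : List (Fin g) => (List.casesOn l [e' (.cell U.blank true)]
      fun a l => f true a :: l.map (f false) : List (Fin g')) := by
    have hmap : Primrec fun l : List (Fin g) => l.map (f false) :=
      Primrec.list_map Primrec.id ((Primrec.dom_finite (f false)).comp₂ Primrec₂.right)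
    have hcons : Primrec₂ fun (_ : List (Fin g)) (p : Fin g × List (Fin g)) =>
        f true p.1 :: p.2.map (f false) :=
      Primrec.list_cons.comp ((Primrec.dom_finite (f true)).comp (Primrec.fst.comp Primrec.snd))
        (hmap.comp (Primrec.snd.comp Primrec.snd))
    exact Primrec.list_casesOn Primrec.id (Primrec.const _) hcons
  refine ((Primrec.list_cons.comp (Primrec.const (e' .delim))
    (Primrec.list_concat.comp hmatch (Primrec.const (e' .delim)))).to_comp.comp he).of_eq
      fun x => ?_
  dsimp only
  generalize code x = w
  cases w <;> simp [TM.frame, f, Function.comp_def]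

namespace TM

theorem exists_isUniversal :
    ∃ (Q Γ : Type) (_ : Finite Q) (_ : Finite Γ) (U : TM Q Γ), U.IsUniversal := by
  obtain ⟨s, g, U, code, hcode, hU⟩ := TMDescription.rePred_run_eq_none.exists_TM
  exact ⟨Fin s, Fin g, inferInstance, inferInstance, U, code,
    ⟨g, Equiv.refl _, by simpa using hcode⟩,
    fun x => (hU x).1, fun s g N w _ => (hU _).2.trans (N.haltsOn_iff_description w).symm⟩

/-- Whether a universal machine halts is undecidable, since some Turing machine halts on an encoding
of a program if and only if the program halts. -/
theorem not_computablePred_of_universal {Q Γ : Type} (U : TM Q Γ)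
    (code : TMDescription × List ℕ → List Γ)
    (h : ∀ (s g : ℕ) (N : TM (Fin s) (Fin g)) (w : List (Fin g)), N.IsInput w →
      (U.HaltsOn (code (N.description, w.map Fin.val)) ↔ N.HaltsOn w)) :
    ¬ ComputablePred fun x => U.HaltsOn (code x) := by
  intro hcomp
  obtain ⟨s, g, N, enc, henc, hN⟩ := (ComputablePred.halting_problem_re 0).exists_TM
  refine ComputablePred.halting_problem 0 (ComputablePred.computable_of_manyOneReducible
    ⟨fun c => (N.description, (enc c).map Fin.val), ?_, fun c => ?_⟩ hcomp)
  · have hval : Primrec fun l : List (Fin g) => l.map Fin.val :=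
      Primrec.list_map Primrec.id ((Primrec.dom_finite Fin.val).comp₂ Primrec₂.right)
    exact (Computable.const _).pair (hval.to_comp.comp henc)
  · exact ((h s g N (enc c) (hN c).1).trans (hN c).2).symm

theorem IsUniversal.shiftMachine {Q Γ : Type} [Finite Γ] {U : TM Q Γ} (hU : U.IsUniversal) :
    U.shiftMachine.SolvesHaltingProblemBefore 18 ∧ U.shiftMachine.IsHypercomputer := by
  obtain ⟨code, hcode, -, hhalt⟩ := hU
  refine ⟨⟨fun x => U.frame (code x), hcode.frame U, fun s g N w hw => ?_⟩, ?_⟩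
  · rw [← hhalt s g N w hw]
    exact U.shiftMachine_answersBefore _
  · exact ⟨_, inferInstance, fun x => U.HaltsOn (code x), fun x => U.frame (code x), 18,
      not_computablePred_of_universal U code hhalt, hcode.frame U, by norm_num,
      fun x => U.shiftMachine_answersBefore _⟩

end TM

theorem mainTheorem1 :
    (∃ (Q Γ : Type) (_ : Finite Q) (_ : Finite Γ) (M : TM Q Γ),
      M.IsHypercomputer ∧ M.SolvesHaltingProblemBefore 18) ∧
    (∃ (Q Γ : Type) (_ : Finite Q) (_ : Finite Γ) (U : TM Q Γ), U.IsUniversal) ∧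
    ∀ (Q Γ : Type) [Finite Q] [Finite Γ] (U : TM Q Γ), U.IsUniversal →
      ∃ (Q' : Type) (_ : Finite Q') (V : TM Q' (TrackSymbol Γ)),
        V.ShiftSimulates U ∧
        (∀ w, U.IsInput w → V.AnswersBefore 18 (U.frame w) (U.HaltsOn w)) ∧
        V.SolvesHaltingProblemBefore 18 ∧
        V.IsHypercomputer := by
  obtain ⟨Q, Γ, hQ, hΓ, U, hU⟩ := TM.exists_isUniversal
  refine ⟨⟨Q × ShiftPhase Γ, TrackSymbol Γ, inferInstance, inferInstance, U.shiftMachine,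
    hU.shiftMachine.2, hU.shiftMachine.1⟩, ⟨Q, Γ, hQ, hΓ, U, hU⟩, fun Q Γ _ _ U hU => ?_⟩
  exact ⟨Q × ShiftPhase Γ, inferInstance, U.shiftMachine, U.shiftSimulates_shiftMachine,
    fun w _ => U.shiftMachine_answersBefore w, hU.shiftMachine.1, hU.shiftMachine.2⟩
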